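/- Let $A$ be a non-zero commutative ring. For $n\geq 1$ let $\mathcal L^n(A)=A((t_1))\cdots((t_n))$ be the ring of iterated Laurent series, where $R((t))=R[[t]][t^{-1}]$; it is an $A$-algebra, and each $f\in\mathcal L^n(A)$ is written $f=\sum_{l\in\mathbb Z^n}a_l\,t_1^{l_1}\cdots t_n^{l_n}$ with $a_l\in A$ and $\operatorname{supp}(f)=\{l\in\mathbb Z^n : a_l\neq 0\}$. Put $\Lambda_1=\mathbb Z$ and $\mathbb Z^1_\lambda=\{l\in\mathbb Z : l\geq\lambda\}$ for $\lambda\in\Lambda_1$; for $n\geq 2$ let $\Lambda_n=\operatorname{Map}(\mathbb Z,\Lambda_{n-1})\times\mathbb Z$ and, for $\lambda=(\lambda',\lambda_n)\in\Lambda_n$, $$\mathbb Z^n_\lambda=\{(l_1,\ldots,l_n)\in\mathbb Z^n : l_n\geq\lambda_n,\ (l_1,\ldots,l_{n-1})\in\mathbb Z^{n-1}_{\lambda'(l_n)}\}.$$ Equip $\mathcal L^n(A)$ with the topology of an additive topological group in which the $A$-submodules $$U_\lambda=\{f\in\mathcal L^n(A) : \operatorname{supp}(f)\cap(-\mathbb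 Z^n_\lambda)=\varnothing\},\qquad \lambda\in\Lambda_n,$$ form a base of open neighbourhoods of zero. If $n>m\geq 1$, then there is no continuous (unital) homomorphism of $A$-algebras $\mathcal L^n(A)\to\mathcal L^m(A)$. -/

import Mathlib

universe u

/-- The coefficientwise `A`-algebra structure on `R((t))`; naming it makes it take precedence over
the (propositionally equal) structure that factors through power series. -/
noncomputable instance LaurentSeries.coeffAlgebra (A R : Type*) [CommRing A] [CommRing R] [Algebra A R] :
    Algebra A (LaurentSeries R) :=
  HahnSeries.instAlgebra

/-- The `A`-algebra `A((t₁))…((tₙ))`, bundled so that the recursion on `n` carries the algebra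
structure along: one starts with `A` and adjoins one variable after the other. -/
noncomputable def iterLaurentAlg (A : Type u) [CommRing A] : ℕ → CommAlgCat.{u} A
  | 0 => CommAlgCat.of A A
  | n + 1 => CommAlgCat.of A (LaurentSeries (iterLaurentAlg A n))

/-- The ring `A((t₁))…((tₙ))` of iterated Laurent series over `A`. -/
def IterLaurent (A : Type u) [CommRing A] (n : ℕ) : Type u :=
  iterLaurentAlg A n

namespace IterLaurent

section Algebra

variable (A : Type u) [CommRing A] (n : ℕ)

noncomputable instance instCommRing : CommRing (IterLaurent A n) :=
  inferInstanceAs (CommRing (iterLaurentAlg A n))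

noncomputable instance instAlgebra : Algebra A (IterLaurent A n) :=
  inferInstanceAs (Algebra A (iterLaurentAlg A n))

/-- With no variables, the ring of iterated Laurent series is `A`. -/
noncomputable def zeroEquiv : IterLaurent A 0 ≃ₐ[A] A :=
  (AlgEquiv.refl : A ≃ₐ[A] A)

/-- `A((t₁))…((tₙ₊₁))` is the ring of Laurent series in `tₙ₊₁` over `A((t₁))…((tₙ))`. -/
noncomputable def succEquiv :
    IterLaurent A (n + 1) ≃ₐ[A] LaurentSeries (IterLaurent A n) :=
  (AlgEquiv.refl : LaurentSeries (IterLaurent A n) ≃ₐ[A] LaurentSeries (IterLaurent A n))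

end Algebra

variable {A : Type u} [CommRing A]

/-- The coefficient `a_l ∈ A` of `t₁^{l₁} ⋯ tₙ^{lₙ}` in an iterated Laurent series; the last
coordinate of `l` is the exponent of the outermost variable. -/
noncomputable def coeff : {n : ℕ} → IterLaurent A n → (Fin n → ℤ) → A
  | 0, f, _ => zeroEquiv A f
  | n + 1, f, l => coeff ((succEquiv A n f).coeff (l (Fin.last n))) (Fin.init l)

theorem coeff_add {n : ℕ} (f g : IterLaurent A n) (l : Fin n → ℤ) :
    coeff (f + g) l = coeff f l + coeff g l := by
  induction n with
  | zero => simp [coeff]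
  | succ n ih => simp [coeff, ih]

theorem coeff_smul {n : ℕ} (a : A) (f : IterLaurent A n) (l : Fin n → ℤ) :
    coeff (a • f) l = a * coeff f l := by
  induction n with
  | zero => simp [coeff]
  | succ n ih => rw [coeff, map_smul, HahnSeries.coeff_smul, ih, coeff]

theorem coeff_zero {n : ℕ} (l : Fin n → ℤ) : coeff (0 : IterLaurent A n) l = 0 := by
  simpa using coeff_smul (0 : A) (0 : IterLaurent A n) l

/-- The set of exponents with non-zero coefficient. -/
def supp {n : ℕ} (f : IterLaurent A n) : Set (Fin n → ℤ) :=
  {l | coeff f l ≠ 0}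

end IterLaurent

/-- The index sets `Λₙ`, with `Λ₀` a point and `Λₙ₊₁ = Map(ℤ, Λₙ) × ℤ`
(so that `Λ₁` is identified with `ℤ`). -/
def LaurentIndex : ℕ → Type
  | 0 => Unit
  | n + 1 => (ℤ → LaurentIndex n) × ℤ

namespace LaurentIndex

/-- The subset `ℤⁿ_λ ⊆ ℤⁿ` attached to `λ ∈ Λₙ`: for `λ = (λ', λₙ₊₁)` it consists of those
`(l₁, …, lₙ₊₁)` with `lₙ₊₁ ≥ λₙ₊₁` and `(l₁, …, lₙ) ∈ ℤⁿ_{λ'(lₙ₊₁)}`. -/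
def cone : {n : ℕ} → LaurentIndex n → Set (Fin n → ℤ)
  | 0, _ => Set.univ
  | n + 1, lam =>
    {l | lam.2 ≤ l (Fin.last n) ∧ Fin.init l ∈ cone (lam.1 (l (Fin.last n)))}

/-- Some element of `Λₙ`. -/
def default : (n : ℕ) → LaurentIndex n
  | 0 => ()
  | n + 1 => (fun _ => default n, 0)

/-- The pointwise minimum of two elements of `Λₙ`. -/
def inf : {n : ℕ} → LaurentIndex n → LaurentIndex n → LaurentIndex n
  | 0, _, _ => ()
  | _ + 1, lam, mu => (fun i => inf (lam.1 i) (mu.1 i), min lam.2 mu.2)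

theorem cone_union_subset {n : ℕ} (lam mu : LaurentIndex n) :
    cone lam ∪ cone mu ⊆ cone (inf lam mu) := by
  induction n with
  | zero => exact fun _ _ => trivial
  | succ n ih =>
    rintro l (⟨h, h'⟩ | ⟨h, h'⟩)
    · exact ⟨(min_le_left _ _).trans h, ih _ _ (Or.inl h')⟩
    · exact ⟨(min_le_right _ _).trans h, ih _ _ (Or.inr h')⟩

end LaurentIndex

namespace IterLaurent

open scoped Pointwise

variable {A : Type u} [CommRing A]

variable (A) in
/-- The basic neighbourhood of zero `U_λ`: the `A`-submodule of all iterated Laurent series `f`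
with `supp(f) ∩ (-ℤⁿ_λ) = ∅`. -/
def nhdZero {n : ℕ} (lam : LaurentIndex n) : Submodule A (IterLaurent A n) where
  carrier := {f | supp f ∩ -lam.cone = ∅}
  zero_mem' := by
    ext l
    simp [supp, coeff_zero]
  add_mem' := by
    intro f g hf hg
    simp only [Set.mem_ofPred_eq, Set.eq_empty_iff_forall_notMem, Set.mem_inter_iff, supp, not_and',
      not_not, ne_eq] at hf hg ⊢
    intro l hl
    rw [coeff_add, hf l hl, hg l hl, add_zero]
  smul_mem' := by
    intro a f hf
    simp only [Set.mem_ofPred_eq, Set.eq_empty_iff_forall_notMem, Set.mem_inter_iff, supp, not_and',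
      not_not, ne_eq] at hf ⊢
    intro l hl
    rw [coeff_smul, hf l hl, mul_zero]

theorem mem_nhdZero {n : ℕ} {lam : LaurentIndex n} {f : IterLaurent A n} :
    f ∈ nhdZero A lam ↔ supp f ∩ -lam.cone = ∅ :=
  Iff.rfl

variable (A) in
/-- The submodules `U_λ`, `λ ∈ Λₙ`, form a filter basis compatible with addition. -/
abbrev nhdBasis (n : ℕ) : AddGroupFilterBasis (IterLaurent A n) where
  sets := {U | ∃ lam : LaurentIndex n, U = (nhdZero A lam : Set (IterLaurent A n))}
  nonempty := ⟨_, LaurentIndex.default n, rfl⟩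
  inter_sets := by
    rintro _ _ ⟨lam, rfl⟩ ⟨mu, rfl⟩
    refine ⟨_, ⟨lam.inf mu, rfl⟩, fun f hf => ⟨?_, ?_⟩⟩
    · refine Set.subset_eq_empty (Set.inter_subset_inter_right _ ?_) hf
      exact fun l hl => LaurentIndex.cone_union_subset lam mu (Or.inl hl)
    · refine Set.subset_eq_empty (Set.inter_subset_inter_right _ ?_) hf
      exact fun l hl => LaurentIndex.cone_union_subset lam mu (Or.inr hl)
  zero' := by
    rintro _ ⟨lam, rfl⟩
    exact (nhdZero A lam).zero_mem
  add' := by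
    rintro _ ⟨lam, rfl⟩
    refine ⟨_, ⟨lam, rfl⟩, ?_⟩
    rintro _ ⟨f, hf, g, hg, rfl⟩
    exact (nhdZero A lam).add_mem hf hg
  neg' := by
    rintro _ ⟨lam, rfl⟩
    exact ⟨_, ⟨lam, rfl⟩, fun f hf => (nhdZero A lam).neg_mem hf⟩
  conj' := by
    rintro f _ ⟨lam, rfl⟩
    refine ⟨_, ⟨lam, rfl⟩, fun g hg => ?_⟩
    simpa using hg

/-- The topology on `A((t₁))…((tₙ))`: the group topology for which the `A`-submodules `U_λ`,
`λ ∈ Λₙ`, form a base of open neighbourhoods of zero. -/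
noncomputable instance instTopologicalSpace (n : ℕ) : TopologicalSpace (IterLaurent A n) :=
  (nhdBasis A n).topology

instance instIsTopologicalAddGroup (n : ℕ) : IsTopologicalAddGroup (IterLaurent A n) :=
  (nhdBasis A n).isTopologicalAddGroup

end IterLaurent

namespace IterLaurent

/-! ### Change of coefficients. -/

section Coefficients

variable {A B : Type*} [CommRing A] [CommRing B]

/-! Reduce coefficients of the target modulo a maximal ideal, so that it becomes a domain with a
`ℤ^m`-valued valuation on its units (`exists_valuation`). Monomials are units, so a homomorphism
induces a map `ℤ^n → ℤ^m`, which kills some `a ≠ 0` because `m < n`. The images of all powers of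
`t^a` then have valuation zero, hence non-zero constant term. But some power of `t^a` lies in any
given `U_λ` (`exists_zsmul_notMem_cone`), so continuity makes the constant term of its image vanish.
-/

theorem coeff_succ {n : ℕ} (f : IterLaurent A (n + 1)) (l : Fin (n + 1) → ℤ) :
    coeff f l = coeff ((succEquiv A n f).coeff (l (Fin.last n))) (Fin.init l) :=
  rfl

/-- The ring homomorphism `A((t₁))…((tₙ)) → B((t₁))…((tₙ))` which applies a ring homomorphism
`A → B` to each coefficient. -/
noncomputable def map (f : A →+* B) : (n : ℕ) → IterLaurent A n →+* IterLaurent B n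
  | 0 => ((zeroEquiv B).symm : B →+* IterLaurent B 0).comp
      (f.comp (zeroEquiv A : IterLaurent A 0 →+* A))
  | n + 1 =>
    ((succEquiv B n).symm : LaurentSeries (IterLaurent B n) →+* IterLaurent B (n + 1)).comp
      (RingHom.comp
        { toFun := fun x => x.map (map f n)
          map_one' := HahnSeries.map_one (map f n).toMonoidWithZeroHom
          map_mul' := fun _ _ =>
            HahnSeries.map_mul (map f n : IterLaurent A n →ₙ+* IterLaurent B n)
          map_zero' := by ext; simp
          map_add' := fun _ _ => by ext; simp }
        (succEquiv A n : IterLaurent A (n + 1) →+* LaurentSeries (IterLaurent A n)))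

theorem coeff_map (f : A →+* B) {n : ℕ} (x : IterLaurent A n) (l : Fin n → ℤ) :
    coeff (map f n x) l = f (coeff x l) := by
  induction n with
  | zero => simp [coeff, map]
  | succ n ih =>
    have h : succEquiv B n (map f (n + 1) x) = (succEquiv A n x).map (map f n) := by
      rw [map]
      exact AlgEquiv.apply_symm_apply _ _
    rw [coeff_succ, h, HahnSeries.map_coeff, ih, coeff_succ]

end Coefficients

/-! ### Monomials as units. -/

section Monomials

variable (A : Type*) [CommRing A]

/-- The monomial `t₁^{l₁} ⋯ tₙ^{lₙ}`. -/
noncomputable def monomial : {n : ℕ} → (Fin n → ℤ) → IterLaurent A n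
  | 0, _ => 1
  | n + 1, l => (succEquiv A n).symm (HahnSeries.single (l (Fin.last n)) (monomial (Fin.init l)))

theorem monomial_zero (n : ℕ) : monomial A (0 : Fin n → ℤ) = 1 := by
  induction n with
  | zero => rfl
  | succ n ih =>
    have h : Fin.init (0 : Fin (n + 1) → ℤ) = 0 := rfl
    rw [monomial, h, ih, Pi.zero_apply, HahnSeries.single_zero_one, map_one]

theorem monomial_add {n : ℕ} (l l' : Fin n → ℤ) :
    monomial A (l + l') = monomial A l * monomial A l' := by
  induction n with
  | zero => exact (one_mul _).symm
  | succ n ih =>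
    have h : Fin.init (l + l') = Fin.init l + Fin.init l' := rfl
    rw [monomial, monomial, monomial, ← map_mul, HahnSeries.single_mul_single, h, ih, Pi.add_apply]

theorem coeff_monomial_of_ne {n : ℕ} {l l' : Fin n → ℤ} (h : l' ≠ l) :
    coeff (monomial A l) l' = 0 := by
  induction n with
  | zero => exact absurd (Subsingleton.elim _ _) h
  | succ n ih =>
    rw [coeff_succ, monomial, AlgEquiv.apply_symm_apply]
    by_cases hl : l' (Fin.last n) = l (Fin.last n)
    · rw [hl, HahnSeries.coeff_single_same]
      refine ih fun hi => h ?_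
      rw [← Fin.snoc_init_self l', ← Fin.snoc_init_self l, hi, hl]
    · rw [HahnSeries.coeff_single_of_ne hl, coeff_zero]

/-- The group homomorphism `l ↦ t₁^{l₁} ⋯ tₙ^{lₙ}` from `ℤⁿ` to the units. -/
noncomputable def monomialUnit (n : ℕ) : Multiplicative (Fin n → ℤ) →* (IterLaurent A n)ˣ :=
  MonoidHom.toHomUnits
    { toFun := fun l => monomial A l.toAdd
      map_one' := monomial_zero A n
      map_mul' := fun l l' => monomial_add A l.toAdd l'.toAdd }

theorem coe_monomialUnit {n : ℕ} (l : Fin n → ℤ) :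
    (monomialUnit A n (Multiplicative.ofAdd l) : IterLaurent A n) = monomial A l :=
  rfl

theorem monomial_mem_nhdZero {n : ℕ} {lam : LaurentIndex n} {l : Fin n → ℤ}
    (h : -l ∉ lam.cone) : monomial A l ∈ nhdZero A lam := by
  rw [mem_nhdZero, Set.eq_empty_iff_forall_notMem]
  rintro l' ⟨hl', hl'c⟩
  by_cases hl : l' = l
  · exact h (hl ▸ hl'c)
  · exact hl' (coeff_monomial_of_ne A hl)

end Monomials

/-! ### The valuation over a domain. -/

section Domain

variable (A : Type*) [CommRing A] [IsDomain A]

instance instIsDomain (n : ℕ) : IsDomain (IterLaurent A n) := by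
  induction n with
  | zero => exact (zeroEquiv A).toMulEquiv.isDomain A
  | succ n ih => exact (succEquiv A n).toMulEquiv.isDomain _

/-- The exponent of the leading term of an invertible iterated Laurent series is a valuation of
rank `n`; the units on which it vanishes have non-zero constant term. -/
theorem exists_valuation (n : ℕ) :
    ∃ v : (IterLaurent A n)ˣ →* Multiplicative (Fin n → ℤ),
      ∀ y, v y = 1 → coeff (y : IterLaurent A n) 0 ≠ 0 := by
  induction n with
  | zero =>
    refine ⟨1, fun y _ => ?_⟩
    rw [coeff]
    exact (EmbeddingLike.map_ne_zero_iff (f := zeroEquiv A)).2 y.ne_zero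
  | succ n ih =>
    obtain ⟨v, hv⟩ := ih
    let e : (IterLaurent A (n + 1))ˣ →* (LaurentSeries (IterLaurent A n))ˣ :=
      Units.map (succEquiv A n : IterLaurent A (n + 1) →* LaurentSeries (IterLaurent A n))
    -- Leading coefficients multiply because the coefficient ring is a domain, so units go to units
    -- and `v` applies again.
    let lead : (LaurentSeries (IterLaurent A n))ˣ →* (IterLaurent A n)ˣ :=
      Units.map
        { toFun := HahnSeries.leadingCoeff
          map_one' := HahnSeries.leadingCoeff_one
          map_mul' := fun x y => HahnSeries.leadingCoeff_mul x y }
    refine ⟨{ toFun := fun y => Multiplicative.ofAdd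
                (Fin.snoc (v (lead (e y))).toAdd (e y).val.order : Fin (n + 1) → ℤ)
              map_one' := ?_
              map_mul' := fun x y => ?_ }, fun y hy => ?_⟩
    · rw [← ofAdd_zero]
      congr 1
      ext i
      refine Fin.lastCases ?_ (fun i => ?_) i <;> simp
    · rw [← ofAdd_add]
      congr 1
      ext i
      refine Fin.lastCases ?_ (fun i => ?_) i
      · simp [HahnSeries.order_mul (e x).ne_zero (e y).ne_zero]
      · simp
    · have hy' : (Fin.snoc (v (lead (e y))).toAdd (e y).val.order : Fin (n + 1) → ℤ) = 0 :=
        Multiplicative.ofAdd.injective hy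
      have hord : (e y).val.order = 0 := by simpa using congrFun hy' (Fin.last n)
      have hlead : v (lead (e y)) = 1 := by
        refine Multiplicative.toAdd.injective (funext fun i => ?_)
        simpa using congrFun hy' i.castSucc
      have h := hv _ hlead
      have hc : (lead (e y)).val = (e y).val.coeff 0 := by
        rw [← hord]
        exact HahnSeries.leadingCoeff_eq
      rwa [hc] at h

end Domain

end IterLaurent

/-! ### Multiples of an exponent and kernels. -/

namespace LaurentIndex

theorem zero_mem_cone_default (n : ℕ) : (0 : Fin n → ℤ) ∈ cone (default n) := by
  induction n with
  | zero => trivial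
  | succ n ih => exact ⟨le_rfl, ih⟩

theorem exists_zsmul_notMem_cone {n : ℕ} {a : Fin n → ℤ} (ha : a ≠ 0) (lam : LaurentIndex n) :
    ∃ j : ℤ, -(j • a) ∉ lam.cone := by
  induction n with
  | zero => exact absurd (Subsingleton.elim _ _) ha
  | succ n ih =>
    -- If the last coordinate of `a` is zero, all multiples stay in the slice over `0`, governed by
    -- `lam.1 0`.
    by_cases h : a (Fin.last n) = 0
    · have hi : Fin.init a ≠ 0 := fun hi => ha <| by
        ext i
        refine Fin.lastCases h (fun i => congrFun hi i) i
      obtain ⟨j, hj⟩ := ih hi (lam.1 0)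
      refine ⟨j, fun hc => hj ?_⟩
      have hc2 := hc.2
      rwa [show (-(j • a)) (Fin.last n) = 0 by simp [h]] at hc2
    -- The factor `a (Fin.last n)` makes the last coordinate of `-(j • a)` equal to minus a square
    -- times `|lam.2| + 1`, below `lam.2` for either sign of `a (Fin.last n)`.
    · refine ⟨a (Fin.last n) * (|lam.2| + 1), fun hc => ?_⟩
      have h1 := hc.1
      simp only [Pi.neg_apply, Pi.smul_apply, smul_eq_mul] at h1
      have h2 : 1 ≤ a (Fin.last n) * a (Fin.last n) :=
        Int.add_one_le_iff.2 (mul_self_pos.2 h)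
      nlinarith [neg_abs_le lam.2, abs_nonneg lam.2]

end LaurentIndex

theorem AddMonoidHom.exists_ne_zero_map_eq_zero {n m : ℕ} (hnm : m < n)
    (f : (Fin n → ℤ) →+ (Fin m → ℤ)) : ∃ a, a ≠ 0 ∧ f a = 0 := by
  by_contra! h
  have hinj : Function.Injective f.toIntLinearMap :=
    (injective_iff_map_eq_zero f).2 fun a ha => by_contra fun h0 => h a h0 ha
  have := LinearMap.finrank_le_finrank_of_injective hinj
  simp only [Module.finrank_fin_fun] at this
  omega

/-! ### Continuous homomorphisms. -/

namespace IterLaurent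

theorem nhdZero_mem_nhds {A : Type*} [CommRing A] {n : ℕ} (lam : LaurentIndex n) :
    (nhdZero A lam : Set (IterLaurent A n)) ∈ nhds 0 :=
  (nhdBasis A n).mem_nhds_zero ⟨lam, rfl⟩

theorem exists_nhdZero_subset {A : Type*} [CommRing A] {n : ℕ} {s : Set (IterLaurent A n)}
    (hs : s ∈ nhds 0) : ∃ lam : LaurentIndex n, (nhdZero A lam : Set (IterLaurent A n)) ⊆ s := by
  obtain ⟨_, ⟨lam, rfl⟩, h⟩ := (nhdBasis A n).nhds_zero_hasBasis.mem_iff.1 hs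
  exact ⟨lam, h⟩

/-- If `n > m`, some non-trivial monomial has an image of valuation zero, all powers of which have
non-zero constant term, although some of these powers come from monomials close to zero. -/
theorem not_continuous_of_lt {A : Type*} [CommRing A] [Nontrivial A] {n m : ℕ} (hnm : m < n)
    (φ : IterLaurent A n →+* IterLaurent A m) : ¬ Continuous φ := by
  intro hφ
  obtain ⟨M, hM⟩ := Ideal.exists_maximal A
  let ψ : IterLaurent A n →+* IterLaurent (A ⧸ M) m := (map (Ideal.Quotient.mk M) m).comp φ
  obtain ⟨v, hv⟩ := exists_valuation (A ⧸ M) m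
  let w : Multiplicative (Fin n → ℤ) →* Multiplicative (Fin m → ℤ) :=
    v.comp ((Units.map (ψ : IterLaurent A n →* IterLaurent (A ⧸ M) m)).comp (monomialUnit A n))
  obtain ⟨a, ha, hwa⟩ := AddMonoidHom.exists_ne_zero_map_eq_zero hnm (AddMonoidHom.toMultiplicative.symm w)
  -- The default cone contains `0`, so this neighbourhood forces the constant term to vanish.
  -- Continuity is applied to `φ` itself, before reduction modulo `M`.
  have hs : φ ⁻¹' (nhdZero A (LaurentIndex.default m)) ∈ nhds 0 :=
    hφ.continuousAt.preimage_mem_nhds (by rw [map_zero]; exact nhdZero_mem_nhds _)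
  obtain ⟨lam, hlam⟩ := exists_nhdZero_subset hs
  obtain ⟨j, hj⟩ := LaurentIndex.exists_zsmul_notMem_cone ha lam
  have hmem : φ (monomial A (j • a)) ∈ nhdZero A (LaurentIndex.default m) :=
    hlam (monomial_mem_nhdZero A hj)
  have hw : w (Multiplicative.ofAdd (j • a)) = 1 := by
    have : AddMonoidHom.toMultiplicative.symm w (j • a) = 0 := by rw [map_zsmul, hwa, smul_zero]
    exact this
  refine hv _ hw ?_
  change coeff (map (Ideal.Quotient.mk M) m (φ (monomial A (j • a)))) 0 = 0
  rw [coeff_map]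
  have h0 : coeff (φ (monomial A (j • a))) 0 = 0 := by
    by_contra h
    refine Set.eq_empty_iff_forall_notMem.1 (mem_nhdZero.1 hmem) 0 ⟨h, ?_⟩
    rw [Set.mem_neg, neg_zero]
    exact LaurentIndex.zero_mem_cone_default m
  rw [h0, map_zero]

end IterLaurent

theorem mainTheorem9 {A : Type u} [CommRing A] [Nontrivial A] {n m : ℕ} (hm : 1 ≤ m)
    (hnm : m < n) :
    ¬ ∃ φ : IterLaurent A n →ₐ[A] IterLaurent A m, Continuous φ := by
  rintro ⟨φ, hφ⟩
  exact IterLaurent.not_continuous_of_lt hnm φ.toRingHom hφ
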